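/- Let $(R,\mathfrak m)$ be a Noetherian local ring and let $M$ be a finitely generated $R$-module of dimension $t\ge 1$ (the Krull dimension of $\operatorname{Supp} M$). Write $\ell_R$ for length, and for a submodule $N\subseteq M$ put $N:_M\mathfrak m=\{x\in M\mid \mathfrak m x\subseteq N\}$. Then there are integers $\mathrm e_{\mathfrak m}^0(M),\dots,\mathrm e_{\mathfrak m}^t(M)$ and $\mathrm f_{\mathfrak m}^0(M),\dots,\mathrm f_{\mathfrak m}^{t-1}(M)$ such that for all $n\gg 0$ the following lengths are finite and \[ \ell_R(M/\mathfrak m^{n+1}M)=\sum_{i=0}^{t}(-1)^i\,\mathrm e_{\mathfrak m}^i(M)\binom{n+t-i}{t-i}, \] \[ \ell_R\big((\mathfrak m^{n+1}M:_M\mathfrak m)/\mathfrak m^{n+1}M\big)=\sum_{i=0}^{t-1}(-1)^i\,\mathrm f_{\mathfrak m}^i(M)\binom{n+t-1-i}{t-1-i}. \] The leading coefficients $\mathrm e_{\mathfrak m}^0(M)$ (the Hilbert multiplicity) and $\mathrm f_{\mathfrak m}^0(M)$ (the irreducible multiplicity) are uniquely determined, $\ell_R((0):_M\mathfrak m)$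 is finite when $t=1$, and \[ \mathrm f_{\mathfrak m}^0(M)= \begin{cases} \mathrm e_{\mathfrak m}^0(M) & \text{if } t\ne 1,\\ \mathrm e_{\mathfrak m}^0(M)+\ell_R((0):_M\mathfrak m) & \text{if } t=1. \end{cases} \] -/

import Mathlib

namespace IrrMult

section

variable {R : Type*} [CommRing R] {M : Type*} [AddCommGroup M] [Module R M]

/-- The submodule `N :_M J = {x ∈ M | J x ⊆ N}` of `M`. -/
def moduleColon (N : Submodule R M) (J : Ideal R) : Submodule R M where
  carrier := {x | ∀ r ∈ J, r • x ∈ N}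
  zero_mem' := fun r _ => by simp
  add_mem' := fun {a b} ha hb r hr => by
    rw [smul_add]
    exact N.add_mem (ha r hr) (hb r hr)
  smul_mem' := fun c x hx r hr => by
    rw [smul_comm]
    exact N.smul_mem c (hx r hr)

variable (M)

/-- `e 0, …, e t` are integers such that, for all large `n`, the length of `M / I ^ (n + 1) M` is
finite and equal to `∑ i ≤ t, (-1) ^ i * e i * binom (n + t - i) (t - i)`. -/
def HasHilbertCoeffs (I : Ideal R) (t : ℕ) (e : Fin (t + 1) → ℤ) : Prop :=
  ∀ᶠ n : ℕ in Filter.atTop, ∃ k : ℕ,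
    Module.length R (M ⧸ (I ^ (n + 1) • (⊤ : Submodule R M))) = (k : ℕ∞) ∧
    (k : ℤ) = ∑ i : Fin (t + 1),
      (-1) ^ (i : ℕ) * e i * (Nat.choose (n + (t - (i : ℕ))) (t - (i : ℕ)) : ℤ)

/-- `a` is the Hilbert multiplicity of `M` with respect to `I`: the coefficient `e 0` of a family
of Hilbert coefficients of `M`, where `t` is the dimension of `M`. -/
def IsHilbertMultiplicity (I : Ideal R) (a : ℤ) : Prop :=
  ∃ t : ℕ, Module.supportDim R M = (t : WithBot ℕ∞) ∧
    ∃ e : Fin (t + 1) → ℤ, HasHilbertCoeffs M I t e ∧ e 0 = a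

end

section

variable {R : Type*} [CommRing R] [IsLocalRing R] (M : Type*) [AddCommGroup M] [Module R M]

/-- `f 0, …, f (t - 1)` are integers such that, for all large `n`, the length of
`(I ^ (n + 1) M :_M 𝔪) / I ^ (n + 1) M` is finite and equal to
`∑ i ≤ t - 1, (-1) ^ i * f i * binom (n + t - 1 - i) (t - 1 - i)`. -/
def HasIrreducibilityCoeffs (I : Ideal R) (t : ℕ) (f : Fin t → ℤ) : Prop :=
  ∀ᶠ n : ℕ in Filter.atTop, ∃ k : ℕ,
    Module.length R
      (moduleColon (I ^ (n + 1) • (⊤ : Submodule R M)) (IsLocalRing.maximalIdeal R) ⧸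
        (I ^ (n + 1) • (⊤ : Submodule R M)).submoduleOf
          (moduleColon (I ^ (n + 1) • (⊤ : Submodule R M)) (IsLocalRing.maximalIdeal R)))
      = (k : ℕ∞) ∧
    (k : ℤ) = ∑ i : Fin t,
      (-1) ^ (i : ℕ) * f i * (Nat.choose (n + (t - 1 - (i : ℕ))) (t - 1 - (i : ℕ)) : ℤ)

/-- `a` is the irreducible multiplicity of `M` with respect to `I`: the coefficient `f 0` of a
family of irreducibility coefficients of `M`, where `t` is the (positive) dimension of `M`. -/
def IsIrreducibleMultiplicity (I : Ideal R) (a : ℤ) : Prop :=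
  ∃ (t : ℕ) (ht : 0 < t), Module.supportDim R M = (t : WithBot ℕ∞) ∧
    ∃ f : Fin t → ℤ, HasIrreducibilityCoeffs M I t f ∧ f ⟨0, ht⟩ = a

end

end IrrMult

open Filter
open scoped Pointwise

/-! Write χ(n) = ℓ(M/𝔪^(n+1)M) and Δ for the backward difference. The key fact is that for large n
the colon (𝔪^(n+1)M : 𝔪) is 𝔪^n M + (0 : 𝔪), a direct sum (`eventually_moduleColon_pow_eq`,
`eventually_pow_inf_moduleColon_bot_eq_bot`). Hence its length over 𝔪^(n+1)M is Δχ(n) + ℓ(0 : 𝔪).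
Taking t - 1 further differences gives f⁰ = e⁰ + Δ^(t-1) ℓ(0 : 𝔪), and the last term survives only
for t = 1.

The colon formula combines Artin–Rees, which puts the colon inside 𝔪^N M + (0 : 𝔪), with eventual
injectivity of multiplication by 𝔪 on the associated graded module, which raises N to n.

That χ is of polynomial type comes from Hilbert–Serre (`IsNoetherianPair.bdiff_pow_card`). Its
degree is at most t by comparison with the powers of an ideal of parameters. "Polynomial of degree
at most d" is encoded as Δ^(d+1) vanishing eventually, and the leading binomial coefficient is then
the eventual value of Δ^d. -/

namespace IrrMult

/-! ### Difference calculus for sequences of polynomial type -/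

/-- The shift operator `h ↦ (n ↦ h (n - 1))` on integer sequences. -/
def seqShift : Module.End ℤ (ℕ → ℤ) := LinearMap.funLeft ℤ ℤ (fun n => n - 1)

/-- The backward difference operator `h ↦ (n ↦ h n - h (n - 1))` on integer sequences. -/
def bdiff : Module.End ℤ (ℕ → ℤ) := 1 - seqShift

/-- Truncated subtraction makes the value at n = 0 zero; this is harmless because only eventual
values matter. -/
lemma bdiff_apply (h : ℕ → ℤ) (n : ℕ) : bdiff h n = h n - h (n - 1) := rfl

lemma seqShift_eventuallyEq {h g : ℕ → ℤ} (H : h =ᶠ[atTop] g) :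
    seqShift h =ᶠ[atTop] seqShift g :=
  (tendsto_sub_atTop_nat 1).eventually H

lemma bdiff_eventuallyEq {h g : ℕ → ℤ} (H : h =ᶠ[atTop] g) : bdiff h =ᶠ[atTop] bdiff g :=
  H.sub (seqShift_eventuallyEq H)

lemma bdiff_pow_eventuallyEq {h g : ℕ → ℤ} (H : h =ᶠ[atTop] g) (d : ℕ) :
    (bdiff ^ d) h =ᶠ[atTop] (bdiff ^ d) g := by
  induction d with
  | zero => simpa using H
  | succ d ih => simpa only [pow_succ', Module.End.mul_apply] using bdiff_eventuallyEq ih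

lemma bdiff_pow_seqShift (h : ℕ → ℤ) (d : ℕ) :
    (bdiff ^ d) (seqShift h) = seqShift ((bdiff ^ d) h) := by
  have : Commute (bdiff ^ d) seqShift :=
    ((Commute.one_left seqShift).sub_left (Commute.refl seqShift)).pow_left d
  exact LinearMap.congr_fun this.eq h

lemma bdiff_pow_const (c : ℤ) {d : ℕ} (hd : d ≠ 0) : (bdiff ^ d) (fun _ => c) = 0 := by
  obtain ⟨d, rfl⟩ := Nat.exists_eq_succ_of_ne_zero hd
  have : bdiff (fun _ => c) = 0 := by ext n; simp [bdiff_apply]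
  rw [pow_succ, Module.End.mul_apply, this, map_zero]

lemma bdiff_pow_eventually_zero_mono {h : ℕ → ℤ} {d d' : ℕ} (hd : d ≤ d')
    (H : (bdiff ^ d) h =ᶠ[atTop] 0) : (bdiff ^ d') h =ᶠ[atTop] 0 := by
  obtain ⟨k, rfl⟩ := Nat.exists_eq_add_of_le' hd
  rw [pow_add, Module.End.mul_apply]
  simpa using bdiff_pow_eventuallyEq H k

lemma eventually_const_of_bdiff {h : ℕ → ℤ} (H : bdiff h =ᶠ[atTop] 0) :
    ∃ c : ℤ, h =ᶠ[atTop] fun _ => c := by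
  obtain ⟨N, hN⟩ := eventually_atTop.1 H
  refine ⟨h N, eventually_atTop.2 ⟨N, fun n hn => ?_⟩⟩
  induction n, hn using Nat.le_induction with
  | base => rfl
  | succ n hn ih =>
    have := hN (n + 1) (by omega)
    simp only [bdiff_apply, Pi.zero_apply, Nat.add_sub_cancel] at this
    change h (n + 1) = h N
    change h n = h N at ih
    omega

/-- A sequence whose iterated difference is eventually positive is eventually positive. -/
lemma eventually_pos_of_bdiff_pow (d : ℕ) {h : ℕ → ℤ}
    (H : ∀ᶠ n in atTop, 1 ≤ (bdiff ^ d) h n) : ∀ᶠ n in atTop, 1 ≤ h n := by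
  induction d with
  | zero => simpa using H
  | succ d ih =>
    apply ih
    rw [pow_succ'] at H
    obtain ⟨N, hN⟩ := eventually_atTop.1 H
    set g := (bdiff ^ d) h
    have key : ∀ k : ℕ, g N + k ≤ g (N + k) := by
      intro k
      induction k with
      | zero => simp
      | succ k ih =>
        have := hN (N + (k + 1)) (by omega)
        simp only [Module.End.mul_apply, bdiff_apply] at this
        rw [show N + (k + 1) - 1 = N + k by omega] at this
        push_cast
        change 1 ≤ g (N + (k + 1)) - g (N + k) at this
        omega
    -- From N on, g gains at least 1 per step, so 1 - g N steps suffice to reach 1.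
    refine eventually_atTop.2 ⟨N + (1 - g N).toNat, fun n hn => ?_⟩
    have := key (n - N)
    rw [show N + (n - N) = n by omega] at this
    omega

/-- A nonnegative sequence of polynomial type that is bounded by a sequence of polynomial type
of degree less than `d` has degree less than `d`. -/
lemma bdiff_pow_eventually_zero_of_le {h g : ℕ → ℤ} {d : ℕ} (s : ℕ)
    (hs : (bdiff ^ s) h =ᶠ[atTop] 0) (hg : (bdiff ^ d) g =ᶠ[atTop] 0)
    (h0 : ∀ n, 0 ≤ h n) (hle : ∀ n, h n ≤ g n) : (bdiff ^ d) h =ᶠ[atTop] 0 := by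
  induction s with
  | zero => exact bdiff_pow_eventually_zero_mono (Nat.zero_le d) hs
  | succ s ih =>
    rcases Nat.lt_or_ge s d with hsd | hsd
    · exact bdiff_pow_eventually_zero_mono hsd hs
    apply ih
    rw [pow_succ'] at hs
    -- The s-th difference of h is eventually a constant c, while that of g vanishes because s ≥ d.
    -- So c < 0 would make h negative, and c > 0 would make h exceed g.
    obtain ⟨c, hc⟩ := eventually_const_of_bdiff hs
    have hg' := bdiff_pow_eventually_zero_mono hsd hg
    rcases lt_trichotomy c 0 with hc0 | rfl | hc0
    · have : ∀ᶠ n in atTop, 1 ≤ (-h) n := by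
        apply eventually_pos_of_bdiff_pow s
        filter_upwards [hc] with n hn
        simp only [map_neg, Pi.neg_apply, hn]
        omega
      obtain ⟨n, hn⟩ := this.exists
      have := h0 n
      simp only [Pi.neg_apply] at hn
      omega
    · exact hc
    · have : ∀ᶠ n in atTop, 1 ≤ (h - g) n := by
        apply eventually_pos_of_bdiff_pow s
        filter_upwards [hc, hg'] with n hn hn'
        simp only [map_sub, Pi.sub_apply, hn, hn', Pi.zero_apply]
        omega
      obtain ⟨n, hn⟩ := this.exists
      have := hle n
      simp only [Pi.sub_apply] at hn
      omega

/-- The sequence `n ↦ ∑ i ≤ d, (-1) ^ i * e i * binom (n + d - i) (d - i)`. -/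
def binomialSum (d : ℕ) (e : Fin (d + 1) → ℤ) (n : ℕ) : ℤ :=
  ∑ i : Fin (d + 1),
    (-1) ^ (i : ℕ) * e i * (Nat.choose (n + (d - (i : ℕ))) (d - (i : ℕ)) : ℤ)

lemma binomialSum_succ (d : ℕ) (e : Fin (d + 2) → ℤ) (n : ℕ) :
    binomialSum (d + 1) e n = ∑ i : Fin (d + 1), (-1) ^ (i : ℕ) * e i.castSucc *
      (Nat.choose (n + (d - (i : ℕ) + 1)) (d - (i : ℕ) + 1) : ℤ) +
        (-1) ^ (d + 1) * e (Fin.last (d + 1)) := by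
  rw [binomialSum, Fin.sum_univ_castSucc]
  congr 1
  · refine Finset.sum_congr rfl fun i _ => ?_
    have : d + 1 - (i : ℕ) = d - i + 1 := by omega
    simp only [Fin.val_castSucc, this]
  · simp

/-- Pascal's rule lowers each binomial by one degree, and the constant last term cancels. -/
lemma bdiff_binomialSum (d : ℕ) (e : Fin (d + 2) → ℤ) :
    bdiff (binomialSum (d + 1) e) =ᶠ[atTop] binomialSum d (e ∘ Fin.castSucc) := by
  filter_upwards [eventually_ge_atTop 1] with n hn
  rw [bdiff_apply, binomialSum_succ, binomialSum_succ, binomialSum, add_sub_add_right_eq_sub,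
    ← Finset.sum_sub_distrib]
  refine Finset.sum_congr rfl fun i _ => ?_
  rw [show n + (d - (i : ℕ) + 1) = n + (d - i) + 1 by omega,
    show n - 1 + (d - (i : ℕ) + 1) = n + (d - i) by omega, Nat.choose_succ_succ]
  simp only [Function.comp_apply]
  push_cast
  ring

lemma bdiff_pow_binomialSum (d : ℕ) (e : Fin (d + 1) → ℤ) :
    (bdiff ^ d) (binomialSum d e) =ᶠ[atTop] fun _ => e 0 := by
  induction d with
  | zero => exact Eventually.of_forall fun n => by simp [binomialSum]
  | succ d ih =>
    rw [pow_succ, Module.End.mul_apply]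
    exact (bdiff_pow_eventuallyEq (bdiff_binomialSum d e) d).trans (ih _)

/-- Discrete integration: the coefficients of Δh are those of h except the last, which absorbs the
constant of integration. -/
lemma exists_eventuallyEq_binomialSum (d : ℕ) {h : ℕ → ℤ}
    (H : (bdiff ^ (d + 1)) h =ᶠ[atTop] 0) :
    ∃ e : Fin (d + 1) → ℤ, h =ᶠ[atTop] binomialSum d e := by
  induction d generalizing h with
  | zero =>
    obtain ⟨c, hc⟩ := eventually_const_of_bdiff (by simpa using H)
    exact ⟨fun _ => c, hc.trans (Eventually.of_forall fun n => by simp [binomialSum])⟩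
  | succ d ih =>
    rw [pow_succ, Module.End.mul_apply] at H
    obtain ⟨e, he⟩ := ih H
    have h0 : bdiff (h - binomialSum (d + 1) (Fin.snoc e 0)) =ᶠ[atTop] 0 := by
      have := bdiff_binomialSum d (Fin.snoc e 0)
      filter_upwards [he, this] with n h1 h2
      have h3 : (Fin.snoc e 0 : Fin (d + 2) → ℤ) ∘ Fin.castSucc = e := by
        ext i; simp
      rw [h3] at h2
      simp only [map_sub, Pi.sub_apply, h1, h2, sub_self, Pi.zero_apply]
    obtain ⟨c, hc⟩ := eventually_const_of_bdiff h0
    refine ⟨Fin.snoc e ((-1) ^ (d + 1) * c), ?_⟩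
    filter_upwards [hc] with n hn
    simp only [Pi.sub_apply, binomialSum_succ, Fin.snoc_castSucc, Fin.snoc_last, mul_zero,
      add_zero] at hn ⊢
    rw [← mul_assoc, ← pow_add, (Even.add_self (d + 1)).neg_one_pow]
    linarith

lemma binomialSum_leading_unique {d : ℕ} {e : Fin (d + 1) → ℤ} {h : ℕ → ℤ}
    (H : h =ᶠ[atTop] binomialSum d e) : (bdiff ^ d) h =ᶠ[atTop] fun _ => e 0 :=
  (bdiff_pow_eventuallyEq H d).trans (bdiff_pow_binomialSum d e)

/-! ### Lengths of subquotients and the Hilbert–Serre theorem -/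

section

variable {R : Type*} [CommRing R] {M : Type*} [AddCommGroup M] [Module R M]

lemma length_quotient_eq_add {Q P : Submodule R M} (h : Q ≤ P) :
    Module.length R (M ⧸ Q) =
      Module.length R (P ⧸ Q.submoduleOf P) + Module.length R (M ⧸ P) := by
  refine Module.length_eq_add_of_exact (Submodule.mapQ (Q.submoduleOf P) Q P.subtype le_rfl)
    (Submodule.factor h) ?_ (Submodule.factor_surjective h) ?_
  · refine (injective_iff_map_eq_zero _).2 fun y hy => ?_
    obtain ⟨y, rfl⟩ := Submodule.mkQ_surjective _ y
    exact (Submodule.Quotient.mk_eq_zero _).2 ((Submodule.Quotient.mk_eq_zero Q (x := (y : M))).1 hy)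
  · intro x
    obtain ⟨x, rfl⟩ := Submodule.mkQ_surjective _ x
    constructor
    · intro hx
      exact ⟨Submodule.Quotient.mk ⟨x, (Submodule.Quotient.mk_eq_zero P).1 hx⟩, rfl⟩
    · rintro ⟨y, hy⟩
      obtain ⟨y, rfl⟩ := Submodule.mkQ_surjective _ y
      have : (y : M) - x ∈ Q := (Submodule.Quotient.eq Q).1 hy
      exact (Submodule.Quotient.mk_eq_zero P).2 (by simpa using P.sub_mem y.2 (h this))

/-- First isomorphism theorem for multiplication by a from P onto (Q + aP)/Q. -/
lemma length_sup_smul_quotient (a : R) (P Q : Submodule R M) :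
    Module.length R (↥(Q ⊔ a • P) ⧸ Q.submoduleOf (Q ⊔ a • P)) =
      Module.length R (P ⧸ (P ⊓ Q.comap (LinearMap.lsmul R M a)).submoduleOf P) := by
  let f : P →ₗ[R] ↥(Q ⊔ a • P) ⧸ Q.submoduleOf (Q ⊔ a • P) :=
    (Q.submoduleOf (Q ⊔ a • P)).mkQ ∘ₗ
      LinearMap.codRestrict (Q ⊔ a • P) (LinearMap.lsmul R M a ∘ₗ P.subtype) fun x =>
        Submodule.mem_sup_right (Submodule.smul_mem_pointwise_smul _ a P x.2)
  have hker : LinearMap.ker f = (P ⊓ Q.comap (LinearMap.lsmul R M a)).submoduleOf P := by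
    ext x
    refine (Submodule.Quotient.mk_eq_zero (Q.submoduleOf (Q ⊔ a • P))).trans ?_
    exact ⟨fun h => ⟨x.2, h⟩, fun h => h.2⟩
  have hsurj : Function.Surjective f := by
    intro y
    obtain ⟨⟨y, hy⟩, rfl⟩ := Submodule.mkQ_surjective _ y
    obtain ⟨q, hq, z, hz, rfl⟩ := Submodule.mem_sup.1 hy
    obtain ⟨p, hp, rfl⟩ := (Submodule.mem_smul_pointwise_iff_exists _ _ _).1 hz
    refine ⟨⟨p, hp⟩, (Submodule.Quotient.eq _).2 ?_⟩
    change a • p - (q + a • p) ∈ Q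
    simpa using hq
  rw [← hker]
  exact (LinearMap.quotKerEquivOfSurjective f hsurj).length_eq.symm

/-- The length of `M / N` as a natural number. -/
noncomputable def colength (N : Submodule R M) : ℕ := (Module.length R (M ⧸ N)).toNat

lemma length_quotient_ne_top_of_le {Q P : Submodule R M} (h : Q ≤ P)
    (hQ : Module.length R (M ⧸ Q) ≠ ⊤) : Module.length R (M ⧸ P) ≠ ⊤ :=
  ne_top_of_le_ne_top hQ (Module.length_le_of_surjective _ (Submodule.factor_surjective h))

lemma length_eq_colength {N : Submodule R M} (h : Module.length R (M ⧸ N) ≠ ⊤) :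
    Module.length R (M ⧸ N) = (colength N : ℕ∞) :=
  (ENat.natCast_toNat h).symm

lemma colength_mono {Q P : Submodule R M} (h : Q ≤ P) (hQ : Module.length R (M ⧸ Q) ≠ ⊤) :
    colength P ≤ colength Q :=
  ENat.toNat_le_toNat (Module.length_le_of_surjective _ (Submodule.factor_surjective h)) hQ

lemma length_subquotient_eq {Q P : Submodule R M} (h : Q ≤ P)
    (hQ : Module.length R (M ⧸ Q) ≠ ⊤) :
    ∃ k : ℕ, Module.length R (P ⧸ Q.submoduleOf P) = (k : ℕ∞) ∧
      (k : ℤ) = colength Q - colength P := by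
  have H := length_quotient_eq_add h
  have hP := length_quotient_ne_top_of_le h hQ
  rw [length_eq_colength hQ, length_eq_colength hP] at H
  have hne : Module.length R (P ⧸ Q.submoduleOf P) ≠ ⊤ := by
    intro h0
    rw [h0, top_add] at H
    exact ENat.natCast_ne_top _ H
  obtain ⟨k, hk⟩ := ENat.ne_top_iff_exists.1 hne
  refine ⟨k, hk.symm, ?_⟩
  rw [← hk] at H
  norm_cast at H
  omega

/-- Additivity of length for multiplication by a from P₀/Q₀ to P/Q: the difference of the lengths is
that of cokernel and kernel. -/
lemma colength_sub_colength_smul (a : R) {P Q : Submodule R M} {P₀ Q₀ : Submodule R M}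
    (hQ : Module.length R (M ⧸ Q) ≠ ⊤) (hQ₀ : Module.length R (M ⧸ Q₀) ≠ ⊤)
    (hQP₀ : Q₀ ≤ P₀) (haQ : a • Q₀ ≤ Q) :
    ((colength Q : ℤ) - colength P) - (colength Q₀ - colength P₀) =
      ((colength (Q ⊔ a • P₀) : ℤ) - colength P) -
        (colength Q₀ - colength (P₀ ⊓ Q.comap (LinearMap.lsmul R M a))) := by
  have hK : Q₀ ≤ P₀ ⊓ Q.comap (LinearMap.lsmul R M a) :=
    le_inf hQP₀ fun x hx => haQ (Submodule.smul_mem_pointwise_smul _ _ _ hx)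
  obtain ⟨k, hk, hk'⟩ := length_subquotient_eq (le_sup_left : Q ≤ Q ⊔ a • P₀) hQ
  obtain ⟨l, hl, hl'⟩ := length_subquotient_eq
    (inf_le_left : P₀ ⊓ Q.comap (LinearMap.lsmul R M a) ≤ P₀)
    (length_quotient_ne_top_of_le hK hQ₀)
  rw [length_sup_smul_quotient, hl] at hk
  norm_cast at hk
  subst hk
  omega

/-- The graded subquotient `⨁ P n / Q n` of `M` carries an action of the elements of `s` in
degree one, for which it is Noetherian, and its pieces have finite length. -/
structure IsNoetherianPair (s : Finset R) (P Q : ℕ → Submodule R M) : Prop where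
  le : ∀ n, Q n ≤ P n
  length_ne_top : ∀ n, Module.length R (M ⧸ Q n) ≠ ⊤
  smul_left : ∀ n, Ideal.span (s : Set R) • P n ≤ P (n + 1)
  smul_right : ∀ n, Ideal.span (s : Set R) • Q n ≤ Q (n + 1)
  -- Finite generation of graded submodules, in the only form needed: generators stop appearing in
  -- high degree.
  noetherian : ∀ B : ℕ → Submodule R M, (∀ n, Q n ≤ B n) → (∀ n, B n ≤ P n) →
    (∀ n, Ideal.span (s : Set R) • B n ≤ B (n + 1)) →
    ∀ᶠ n in atTop, B (n + 1) ≤ Q (n + 1) ⊔ Ideal.span (s : Set R) • B n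

lemma span_insert_smul [DecidableEq R] (a : R) (s : Finset R) (N : Submodule R M) :
    Ideal.span ((insert a s : Finset R) : Set R) • N =
      a • N ⊔ Ideal.span (s : Set R) • N := by
  rw [Finset.coe_insert, Ideal.span_insert, Submodule.sup_smul,
    Submodule.ideal_span_singleton_smul]

/-- An element that annihilates a Noetherian graded subquotient can be dropped. -/
lemma IsNoetherianPair.drop [DecidableEq R] {a : R} {s : Finset R}
    {P Q P' Q' : ℕ → Submodule R M} (H : IsNoetherianPair (insert a s) P Q)
    (hQ : ∀ n, Q n ≤ Q' n) (hle : ∀ n, Q' n ≤ P' n) (hP : ∀ n, P' n ≤ P n)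
    (hP' : ∀ n, Ideal.span (s : Set R) • P' n ≤ P' (n + 1))
    (hQ' : ∀ n, Ideal.span (s : Set R) • Q' n ≤ Q' (n + 1))
    (ha : ∀ n, a • P' n ≤ Q' (n + 1)) : IsNoetherianPair s P' Q' where
  le := hle
  length_ne_top n := length_quotient_ne_top_of_le (hQ n) (H.length_ne_top n)
  smul_left := hP'
  smul_right := hQ'
  noetherian B hQB hBP hB := by
    have haB : ∀ n, a • B n ≤ Q' (n + 1) := fun n =>
      (smul_mono_right a (hBP n)).trans (ha n)
    have := H.noetherian B (fun n => (hQ n).trans (hQB n)) (fun n => (hBP n).trans (hP n))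
      (fun n => by
        rw [span_insert_smul]
        exact sup_le ((haB n).trans (hQB _)) (hB n))
    filter_upwards [this] with n hn
    refine hn.trans (sup_le ((hQ _).trans le_sup_left) ?_)
    rw [span_insert_smul]
    exact sup_le ((haB n).trans le_sup_left) le_sup_right

/-- The **Hilbert–Serre theorem** for Noetherian graded subquotients of a module. -/
theorem IsNoetherianPair.bdiff_pow_card (s : Finset R) {P Q : ℕ → Submodule R M}
    (H : IsNoetherianPair s P Q) :
    (bdiff ^ s.card) (fun n => (colength (Q n) : ℤ) - colength (P n)) =ᶠ[atTop] 0 := by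
  classical
  induction s using Finset.induction_on generalizing P Q with
  | empty =>
    -- With no generators left, the condition applied to P itself forces P = Q in high degree.
    have := H.noetherian P H.le (fun _ => le_rfl) H.smul_left
    simp only [Finset.coe_empty, Ideal.span_empty, Submodule.bot_smul, sup_bot_eq] at this
    obtain ⟨N, hN⟩ := eventually_atTop.1 this
    refine eventually_atTop.2 ⟨N + 1, fun n hn => ?_⟩
    obtain ⟨m, rfl⟩ := Nat.exists_eq_add_of_le' (show 1 ≤ n by omega)
    have h1 := le_antisymm (hN m (by omega)) (H.le (m + 1))
    simp [h1]
  | insert a s ha ih =>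
    have hspan : ∀ N : Submodule R M, Ideal.span (s : Set R) • N ≤
        Ideal.span ((insert a s : Finset R) : Set R) • N := fun N => by
      rw [span_insert_smul]; exact le_sup_right
    have hsingle : ∀ N : Submodule R M, a • N ≤
        Ideal.span ((insert a s : Finset R) : Set R) • N := fun N => by
      rw [span_insert_smul]; exact le_sup_left
    -- K/Q is the kernel and P/C the cokernel of multiplication by a; both are killed by a. In
    -- degree 0 nothing comes from below, so C starts at Q 0.
    let K : ℕ → Submodule R M := fun n => P n ⊓ (Q (n + 1)).comap (LinearMap.lsmul R M a)
    let C : ℕ → Submodule R M := fun n => Nat.casesOn n (Q 0) fun m => Q (m + 1) ⊔ a • P m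
    have hQK : ∀ n, Q n ≤ K n := fun n => le_inf (H.le n) fun x hx =>
      H.smul_right n (hsingle _ (Submodule.smul_mem_pointwise_smul _ _ _ hx))
    have hK : IsNoetherianPair s K Q := by
      refine H.drop (fun _ => le_rfl) hQK (fun n => inf_le_left) (fun n => ?_)
        (fun n => (hspan _).trans (H.smul_right n)) (fun n => ?_)
      · refine le_inf ?_ ?_
        · exact (smul_mono_right _ inf_le_left).trans ((hspan _).trans (H.smul_left n))
        · rw [Submodule.smul_le]
          intro r hr x hx
          change a • r • x ∈ Q (n + 2)
          rw [smul_comm]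
          exact H.smul_right (n + 1) (hspan _ (Submodule.smul_mem_smul hr hx.2))
      · intro y hy
        obtain ⟨x, hx, rfl⟩ := (Submodule.mem_smul_pointwise_iff_exists _ _ _).1 hy
        exact hx.2
    have hQC : ∀ n, Q n ≤ C n := fun n => by
      cases n with
      | zero => exact le_rfl
      | succ m => exact le_sup_left
    have hC : IsNoetherianPair s P C := by
      refine H.drop hQC (fun n => ?_) (fun _ => le_rfl)
        (fun n => (hspan _).trans (H.smul_left n)) (fun n => ?_) (fun n => le_sup_right)
      · cases n with
        | zero => exact H.le 0
        | succ m => exact sup_le (H.le _) ((hsingle _).trans (H.smul_left m))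
      · cases n with
        | zero => exact ((hspan _).trans (H.smul_right 0)).trans (hQC 1)
        | succ m =>
          change Ideal.span (s : Set R) • (Q (m + 1) ⊔ a • P m) ≤ Q (m + 2) ⊔ a • P (m + 1)
          rw [Submodule.smul_sup]
          refine sup_le_sup ((hspan _).trans (H.smul_right _)) ?_
          rw [Submodule.smul_le]
          intro r hr y hy
          obtain ⟨x, hx, rfl⟩ := (Submodule.mem_smul_pointwise_iff_exists _ _ _).1 hy
          rw [smul_comm]
          exact Submodule.smul_mem_pointwise_smul _ _ _
            (H.smul_left m (hspan _ (Submodule.smul_mem_smul hr hx)))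
    rw [Finset.card_insert_of_notMem ha, pow_succ, Module.End.mul_apply]
    have key : bdiff (fun n => (colength (Q n) : ℤ) - colength (P n)) =ᶠ[atTop]
        (fun n => (colength (C n) : ℤ) - colength (P n)) -
          seqShift (fun n => (colength (Q n) : ℤ) - colength (K n)) := by
      filter_upwards [eventually_ge_atTop 1] with n hn
      obtain ⟨m, rfl⟩ := Nat.exists_eq_add_of_le' hn
      exact colength_sub_colength_smul a (H.length_ne_top _) (H.length_ne_top m) (H.le m)
        ((hsingle _).trans (H.smul_right m))
    refine (bdiff_pow_eventuallyEq key _).trans ?_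
    rw [map_sub, bdiff_pow_seqShift]
    have h2 := seqShift_eventuallyEq (ih hK)
    simpa using (ih hC).sub h2

end

/-! ### Powers of an ideal and the associated graded module -/

section

variable {R : Type*} [CommRing R] {M : Type*} [AddCommGroup M] [Module R M]

lemma pow_mul_smul_top_le {I J : Ideal R} {k : ℕ}
    (h : J ^ k • (⊤ : Submodule R M) ≤ I • ⊤) (n : ℕ) :
    J ^ (k * n) • (⊤ : Submodule R M) ≤ I ^ n • ⊤ := by
  induction n with
  | zero => simp
  | succ n ih =>
    rw [Nat.mul_succ, pow_add, mul_smul, pow_succ', mul_smul]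
    refine (smul_mono_right _ h).trans ?_
    rw [← mul_smul, mul_comm, mul_smul]
    exact smul_mono_right _ ih

lemma pow_smul_top_antitone (I : Ideal R) :
    Antitone fun n => I ^ n • (⊤ : Submodule R M) := fun _ _ h =>
  Submodule.smul_mono_left (Ideal.pow_le_pow_right h)

lemma smul_pow_smul_top (I : Ideal R) (n : ℕ) :
    I • I ^ n • (⊤ : Submodule R M) = I ^ (n + 1) • ⊤ := by
  rw [pow_succ', mul_smul]

variable [IsNoetherianRing R] [Module.Finite R M]

/-- Any B between the two filtrations is itself a filtration lying in the stable adic one, hence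
stable over a Noetherian ring. -/
lemma isNoetherianPair_pow_smul_top (s : Finset R)
    (h : ∀ n, Module.length R (M ⧸ (Ideal.span (s : Set R) ^ n • (⊤ : Submodule R M))) ≠ ⊤) :
    IsNoetherianPair s (fun n => Ideal.span (s : Set R) ^ n • (⊤ : Submodule R M))
      (fun n => Ideal.span (s : Set R) ^ (n + 1) • (⊤ : Submodule R M)) where
  le n := pow_smul_top_antitone _ n.le_succ
  length_ne_top n := h (n + 1)
  smul_left n := (smul_pow_smul_top _ n).le
  smul_right n := (smul_pow_smul_top _ (n + 1)).le
  noetherian B hQB hBP hB := by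
    let F : (Ideal.span (s : Set R)).Filtration M :=
      ⟨B, fun i => (hBP (i + 1)).trans (hQB i), hB⟩
    obtain ⟨N, hN⟩ := (Ideal.stableFiltration_stable (Ideal.span (s : Set R))
      (⊤ : Submodule R M)).of_le (F' := F) hBP
    filter_upwards [eventually_ge_atTop N] with n hn
    exact (hN n hn).ge.trans le_sup_right

lemma bdiff_pow_card_succ_colength (s : Finset R)
    (h : ∀ n, Module.length R (M ⧸ (Ideal.span (s : Set R) ^ n • (⊤ : Submodule R M))) ≠ ⊤) :
    (bdiff ^ (s.card + 1)) (fun n =>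
      (colength (Ideal.span (s : Set R) ^ (n + 1) • (⊤ : Submodule R M)) : ℤ)) =ᶠ[atTop] 0 := by
  rw [pow_succ, Module.End.mul_apply]
  refine (bdiff_pow_eventuallyEq ?_ _).trans (isNoetherianPair_pow_smul_top s h).bdiff_pow_card
  filter_upwards [eventually_ge_atTop 1] with n hn
  rw [bdiff_apply, Nat.sub_add_cancel hn]

end

/-! ### Parameters and the degree of the Hilbert–Samuel function -/

section

open IsLocalRing

variable {R : Type*} [CommRing R] [IsLocalRing R]

/-- Such a module is a finite-dimensional vector space over the residue field. -/
lemma length_ne_top_of_maximalIdeal_smul_eq_zero (N : Type*) [AddCommGroup N] [Module R N]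
    [Module.Finite R N] (h : ∀ r ∈ maximalIdeal R, ∀ x : N, r • x = 0) :
    Module.length R N ≠ ⊤ := by
  have htors : Module.IsTorsionBySet R N (maximalIdeal R : Set R) := fun x r => h r r.2 x
  let : Module (R ⧸ maximalIdeal R) N := htors.module
  have : IsScalarTower R (R ⧸ maximalIdeal R) N := htors.isScalarTower
  let : Field (R ⧸ maximalIdeal R) := Ideal.Quotient.field _
  have : Module.Finite (R ⧸ maximalIdeal R) N := Module.Finite.of_restrictScalars_finite R _ _
  rw [Module.length_eq_of_surjective (R := R ⧸ maximalIdeal R) Ideal.Quotient.mk_surjective]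
  exact Module.length_ne_top

variable {M : Type*} [AddCommGroup M] [Module R M]

variable [IsNoetherianRing R] [Module.Finite R M]

lemma length_quotient_maximalIdeal_pow_ne_top (k : ℕ) :
    Module.length R (M ⧸ (maximalIdeal R ^ k • (⊤ : Submodule R M))) ≠ ⊤ := by
  induction k with
  | zero =>
    have : Subsingleton (M ⧸ (maximalIdeal R ^ 0 • (⊤ : Submodule R M))) := by
      rw [Submodule.Quotient.subsingleton_iff]; simp
    rw [Module.length_eq_zero]
    exact ENat.zero_ne_top
  | succ k ih =>
    rw [length_quotient_eq_add (pow_smul_top_antitone (M := M) (maximalIdeal R) k.le_succ)]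
    refine WithTop.add_ne_top.2 ⟨length_ne_top_of_maximalIdeal_smul_eq_zero _ fun r hr x => ?_, ih⟩
    obtain ⟨x, rfl⟩ := Submodule.mkQ_surjective _ x
    refine (Submodule.Quotient.mk_eq_zero _).2 ?_
    change r • (x : M) ∈ maximalIdeal R ^ (k + 1) • (⊤ : Submodule R M)
    rw [← smul_pow_smul_top]
    exact Submodule.smul_mem_smul hr x.2

variable (M) in
/-- A finitely generated module of dimension `t` over a Noetherian local ring has a system of
parameters with at most `t` elements. -/
lemma exists_finset_card_le_supportDim {t : ℕ}
    (hdim : Module.supportDim R M = (t : WithBot ℕ∞)) :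
    ∃ s : Finset R, s.card ≤ t ∧ Ideal.span (s : Set R) ≤ maximalIdeal R ∧
      ∃ k : ℕ, maximalIdeal R ^ k • (⊤ : Submodule R M) ≤ Ideal.span (s : Set R) • ⊤ := by
  classical
  set A := Module.annihilator R M
  have hM : Nontrivial M := by
    rw [← Module.supportDim_ne_bot_iff_nontrivial R, hdim]
    exact WithBot.coe_ne_bot
  have hA : A ≠ ⊤ := fun h => by
    obtain ⟨x, hx⟩ := exists_ne (0 : M)
    have : (1 : R) ∈ A := h ▸ Submodule.mem_top
    exact hx (by simpa using Module.mem_annihilator.1 this x)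
  have : Nontrivial (R ⧸ A) := Ideal.Quotient.nontrivial_iff.2 hA
  have : IsLocalRing (R ⧸ A) :=
    IsLocalRing.of_surjective' (Ideal.Quotient.mk A) Ideal.Quotient.mk_surjective
  rw [Module.supportDim_eq_ringKrullDim_quotient_annihilator,
    ← maximalIdeal_height_eq_ringKrullDim] at hdim
  obtain ⟨s', hmin, hcard⟩ :=
    (maximalIdeal (R ⧸ A)).exists_finset_card_eq_height_of_isNoetherianRing
  have hct : s'.card = t := by
    rw [← hcard] at hdim
    exact_mod_cast hdim
  -- A prime containing the parameters lies in the maximal ideal, which is minimal over them, so it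
  -- is the only one.
  have hrad : (Ideal.span (s' : Set (R ⧸ A))).radical = maximalIdeal (R ⧸ A) := by
    rw [Ideal.radical_eq_sInf]
    refine le_antisymm (sInf_le ⟨hmin.1.2, hmin.1.1⟩) (le_sInf ?_)
    rintro p ⟨hp, hpp⟩
    exact hmin.2 ⟨hpp, hp⟩ (le_maximalIdeal hpp.ne_top)
  obtain ⟨k, hk⟩ := (Ideal.span (s' : Set (R ⧸ A))).exists_radical_pow_le_of_fg
    (IsNoetherian.noetherian _)
  rw [hrad] at hk
  let g : R ⧸ A → R := Function.surjInv Ideal.Quotient.mk_surjective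
  have hg : ∀ x, Ideal.Quotient.mk A (g x) = x := Function.surjInv_eq _
  have hmap : (Ideal.span ((s'.image g : Finset R) : Set R)).map (Ideal.Quotient.mk A) =
      Ideal.span (s' : Set (R ⧸ A)) := by
    rw [Ideal.map_span, Finset.coe_image, Set.image_image]
    simp [hg]
  have hloc : (maximalIdeal R).map (Ideal.Quotient.mk A) = maximalIdeal (R ⧸ A) :=
    map_maximalIdeal_of_surjective _ Ideal.Quotient.mk_surjective
  refine ⟨s'.image g, Finset.card_image_le.trans hct.le, le_maximalIdeal fun h => ?_, k, ?_⟩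
  · rw [h, Ideal.map_top] at hmap
    have : (⊤ : Ideal (R ⧸ A)) ≤ maximalIdeal (R ⧸ A) := hmap ▸ hmin.1.2
    exact Ideal.IsPrime.ne_top' (top_le_iff.1 this)
  -- Lifting from R/A back to R costs only the summand A, which annihilates M.
  · have h1 : maximalIdeal R ^ k ≤ Ideal.span ((s'.image g : Finset R) : Set R) ⊔ A := by
      rw [← hloc, ← Ideal.map_pow, ← hmap, Ideal.map_le_iff_le_comap,
        Ideal.comap_map_of_surjective _ Ideal.Quotient.mk_surjective] at hk
      refine hk.trans (sup_le_sup le_rfl ?_)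
      intro x hx
      exact Ideal.Quotient.eq_zero_iff_mem.1 hx
    refine (Submodule.smul_mono_left h1).trans ?_
    rw [Submodule.sup_smul]
    refine sup_le le_rfl ?_
    rw [Submodule.smul_le]
    intro r hr x _
    rw [Module.mem_annihilator.1 hr x]
    exact zero_mem _

/-- The Hilbert–Samuel function `n ↦ ℓ(M / 𝔪 ^ (n + 1) M)`. -/
noncomputable def hilbertSamuel (R : Type*) [CommRing R] [IsLocalRing R] (M : Type*)
    [AddCommGroup M] [Module R M] (n : ℕ) : ℤ :=
  colength (maximalIdeal R ^ (n + 1) • (⊤ : Submodule R M))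

/-- The Hilbert–Samuel function of a module of dimension `t` is eventually a polynomial of degree
at most `t`. -/
theorem bdiff_pow_hilbertSamuel {t : ℕ} (hdim : Module.supportDim R M = (t : WithBot ℕ∞)) :
    (bdiff ^ (t + 1)) (hilbertSamuel R M) =ᶠ[atTop] 0 := by
  obtain ⟨s, hst, hsm, k, hk⟩ := exists_finset_card_le_supportDim M hdim
  -- Generators of 𝔪 give polynomial type with a crude degree; the bound by the parameter ideal,
  -- whose powers lie in those of 𝔪, then lowers it to t.
  obtain ⟨r, hr⟩ := IsNoetherian.noetherian (maximalIdeal R)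
  have h1 := bdiff_pow_card_succ_colength (M := M) r fun n => by
    rw [Ideal.span, hr]; exact length_quotient_maximalIdeal_pow_ne_top n
  rw [Ideal.span, hr] at h1
  have hfin : ∀ n,
      Module.length R (M ⧸ (Ideal.span (s : Set R) ^ n • (⊤ : Submodule R M))) ≠ ⊤ := fun n =>
    length_quotient_ne_top_of_le (pow_mul_smul_top_le hk n)
      (length_quotient_maximalIdeal_pow_ne_top _)
  refine bdiff_pow_eventually_zero_of_le _ h1
    (bdiff_pow_eventually_zero_mono (Nat.succ_le_succ hst)
      (bdiff_pow_card_succ_colength s hfin)) (fun n => Int.natCast_nonneg _) fun n => ?_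
  exact Int.ofNat_le.2 <| colength_mono (Submodule.smul_mono_left (Ideal.pow_right_mono hsm _)) (hfin _)

end

/-! ### Colon submodules of high powers -/

section

open IsLocalRing

variable {R : Type*} [CommRing R] {M : Type*} [AddCommGroup M] [Module R M]

lemma moduleColon_mono {N N' : Submodule R M} (h : N ≤ N') (J : Ideal R) :
    moduleColon N J ≤ moduleColon N' J := fun _ hx r hr => h (hx r hr)

lemma le_moduleColon_iff {N P : Submodule R M} {J : Ideal R} :
    P ≤ moduleColon N J ↔ J • P ≤ N := by
  rw [Submodule.smul_le]
  exact ⟨fun h r hr x hx => h hx r hr, fun h x hx r hr => h r hr x hx⟩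

lemma length_sup_quotient_of_inf_eq_bot {P W : Submodule R M} (h : P ⊓ W = ⊥) :
    Module.length R (↥(P ⊔ W) ⧸ P.submoduleOf (P ⊔ W)) = Module.length R W := by
  let f : W →ₗ[R] ↥(P ⊔ W) ⧸ P.submoduleOf (P ⊔ W) :=
    (P.submoduleOf (P ⊔ W)).mkQ ∘ₗ Submodule.inclusion le_sup_right
  refine (LinearEquiv.ofBijective f ⟨?_, ?_⟩).length_eq.symm
  · refine (injective_iff_map_eq_zero f).2 fun x hx => Subtype.ext ?_
    have hP : (x : M) ∈ P := (Submodule.Quotient.mk_eq_zero (P.submoduleOf (P ⊔ W))).1 hx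
    exact (Submodule.mem_bot R).1 (h ▸ Submodule.mem_inf.2 ⟨hP, x.2⟩)
  · intro y
    obtain ⟨⟨y, hy⟩, rfl⟩ := Submodule.mkQ_surjective _ y
    obtain ⟨p, hp, q, hq, rfl⟩ := Submodule.mem_sup.1 hy
    refine ⟨⟨q, hq⟩, (Submodule.Quotient.eq _).2 ?_⟩
    change q - (p + q) ∈ P
    simpa using hp

variable [IsNoetherianRing R] [Module.Finite R M]

/-- By the **Artin–Rees lemma**, `(I ^ (n + c) M :_M J) ≤ I ^ n M + (0 :_M J)` for some `c`. -/
lemma exists_moduleColon_pow_le_sup (I J : Ideal R) :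
    ∃ c, ∀ n, moduleColon (I ^ (n + c) • (⊤ : Submodule R M)) J ≤
      I ^ n • ⊤ ⊔ moduleColon ⊥ J := by
  obtain ⟨s, hs⟩ := IsNoetherian.noetherian J
  -- φ multiplies by the generators of J, so its kernel lies in (0 : J). Artin–Rees for its range
  -- puts φ x in φ(I^n M) whenever x lies in the colon.
  let φ : M →ₗ[R] (s → M) := LinearMap.pi fun a => LinearMap.lsmul R M (a : R)
  obtain ⟨c, hc⟩ := I.exists_pow_inf_eq_pow_smul (LinearMap.range φ)
  have hpi : ∀ n, ∀ f : s → M, (∀ a, f a ∈ I ^ n • (⊤ : Submodule R M)) →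
      f ∈ I ^ n • (⊤ : Submodule R (s → M)) := by
    classical
    intro n f hf
    rw [← Finset.univ_sum_single f]
    refine Submodule.sum_mem _ fun a _ => ?_
    have : (LinearMap.single R (fun _ : s => M) a) (f a) ∈
        (I ^ n • (⊤ : Submodule R M)).map (LinearMap.single R (fun _ : s => M) a) :=
      Submodule.mem_map_of_mem (hf a)
    rw [Submodule.map_smul''] at this
    exact Submodule.smul_mono le_rfl le_top this
  have hker : LinearMap.ker φ ≤ moduleColon ⊥ J := by
    intro x hx
    have hJ : J ≤ Submodule.annihilator (Submodule.span R {x}) := by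
      rw [← hs, Submodule.span_le]
      intro a ha
      rw [SetLike.mem_coe, Submodule.mem_annihilator_span_singleton]
      exact congr_fun (LinearMap.mem_ker.1 hx) ⟨a, ha⟩
    intro r hr
    exact (Submodule.mem_annihilator_span_singleton x r).1 (hJ hr)
  refine ⟨c, fun n x hx => ?_⟩
  have h1 : φ x ∈ I ^ (n + c) • (⊤ : Submodule R (s → M)) ⊓ LinearMap.range φ :=
    ⟨hpi _ _ fun a => hx a (hs ▸ Submodule.subset_span a.2), ⟨x, rfl⟩⟩
  rw [hc (n + c) (Nat.le_add_left _ _), Nat.add_sub_cancel] at h1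
  have h2 : φ x ∈ (I ^ n • (⊤ : Submodule R M)).map φ := by
    rw [Submodule.map_smul'', Submodule.map_top]
    exact Submodule.smul_mono le_rfl inf_le_right h1
  obtain ⟨y, hy, hyx⟩ := h2
  rw [← sub_add_cancel x y, add_comm]
  refine Submodule.add_mem_sup hy (hker ?_)
  rw [LinearMap.mem_ker, map_sub, hyx, sub_self]

/-- Multiplication by `I` on the associated graded module is eventually injective. -/
lemma eventually_moduleColon_pow_inf_le (I : Ideal R) :
    ∀ᶠ j in atTop, moduleColon (I ^ (j + 2) • (⊤ : Submodule R M)) I ⊓ I ^ j • ⊤ ≤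
      I ^ (j + 1) • ⊤ := by
  have hle : ∀ j, I ^ (j + 1) • (⊤ : Submodule R M) ≤
      moduleColon (I ^ (j + 2) • (⊤ : Submodule R M)) I ⊓ I ^ j • ⊤ := fun j =>
    le_inf (le_moduleColon_iff.2 (smul_pow_smul_top I _).le) (pow_smul_top_antitone I j.le_succ)
  have hsmul : ∀ j, I • (moduleColon (I ^ (j + 2) • (⊤ : Submodule R M)) I ⊓ I ^ j • ⊤) ≤
      I ^ (j + 2) • ⊤ := fun j => le_moduleColon_iff.1 inf_le_left
  -- This filtration is stable, so eventually its term j + 1 is I times its term j, which by the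
  -- colon condition lies in I^(j+2)M.
  let F : I.Filtration M :=
    ⟨fun j => moduleColon (I ^ (j + 2) • (⊤ : Submodule R M)) I ⊓ I ^ j • ⊤,
      fun j => inf_le_right.trans (hle j), fun j => (hsmul j).trans (hle (j + 1))⟩
  obtain ⟨N, hN⟩ := (Ideal.stableFiltration_stable I (⊤ : Submodule R M)).of_le (F' := F)
    fun j => inf_le_right
  refine eventually_atTop.2 ⟨N + 1, fun j hj => ?_⟩
  obtain ⟨j, rfl⟩ := Nat.exists_eq_add_of_le' (show 1 ≤ j by omega)
  exact (hN j (by omega)).ge.trans (hsmul j)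

/-- For large `n`, one has `(I ^ (n + 1) M :_M I) = I ^ n M + (0 :_M I)`. -/
lemma eventually_moduleColon_pow_eq (I : Ideal R) :
    ∀ᶠ n in atTop, moduleColon (I ^ (n + 1) • (⊤ : Submodule R M)) I =
      I ^ n • ⊤ ⊔ moduleColon ⊥ I := by
  obtain ⟨c, hc⟩ := exists_moduleColon_pow_le_sup (M := M) I I
  obtain ⟨N, hN⟩ := eventually_atTop.1 (eventually_moduleColon_pow_inf_le (M := M) I)
  refine eventually_atTop.2 ⟨N + c, fun n hn => le_antisymm ?_ ?_⟩
  -- Injectivity on the graded module moves an element of the colon from I^N M down one power at a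
  -- time, until I^n M.
  · have key : ∀ k, N + k ≤ n → moduleColon (I ^ (n + 1) • (⊤ : Submodule R M)) I ⊓ I ^ N • ⊤ ≤
        I ^ (N + k) • ⊤ := by
      intro k
      induction k with
      | zero => exact fun _ => inf_le_right
      | succ k ih =>
        intro hk
        refine (le_inf (inf_le_left.trans (moduleColon_mono ?_ I)) (ih (by omega))).trans
          (hN (N + k) (by omega))
        exact pow_smul_top_antitone I (show N + k + 2 ≤ n + 1 by omega)
    intro x hx
    have h1 : x ∈ I ^ N • ⊤ ⊔ moduleColon (⊥ : Submodule R M) I :=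
      hc N (moduleColon_mono (pow_smul_top_antitone I (show N + c ≤ n + 1 by omega)) I hx)
    obtain ⟨y, hy, w, hw, rfl⟩ := Submodule.mem_sup.1 h1
    refine Submodule.add_mem_sup ?_ hw
    have hy' : y ∈ moduleColon (I ^ (n + 1) • (⊤ : Submodule R M)) I := by
      have := Submodule.sub_mem _ hx (moduleColon_mono bot_le I hw)
      simpa using this
    have := key (n - N) (by omega) ⟨hy', hy⟩
    rwa [show N + (n - N) = n by omega] at this
  · exact sup_le (le_moduleColon_iff.2 (smul_pow_smul_top I n).le) (moduleColon_mono bot_le I)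

/-- By Artin–Rees the intersection lies in I · (0 : I) = 0 once n exceeds the Artin–Rees constant.
-/
lemma eventually_pow_inf_moduleColon_bot_eq_bot (I : Ideal R) :
    ∀ᶠ n in atTop, I ^ n • ⊤ ⊓ moduleColon (⊥ : Submodule R M) I = ⊥ := by
  obtain ⟨c, hc⟩ := I.exists_pow_inf_eq_pow_smul (moduleColon (⊥ : Submodule R M) I)
  filter_upwards [eventually_ge_atTop (c + 1)] with n hn
  rw [hc n (by omega), eq_bot_iff]
  calc I ^ (n - c) • (I ^ c • ⊤ ⊓ moduleColon (⊥ : Submodule R M) I)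
      ≤ I • moduleColon (⊥ : Submodule R M) I :=
        Submodule.smul_mono (Ideal.pow_le_self (by omega)) inf_le_right
    _ ≤ ⊥ := le_moduleColon_iff.1 le_rfl

end

/-! ### The irreducibility function as Δχ plus the socle length -/

section

open IsLocalRing

variable {R : Type*} [CommRing R] [IsLocalRing R] {M : Type*} [AddCommGroup M] [Module R M]
  [IsNoetherianRing R] [Module.Finite R M]

variable (R M) in
lemma exists_length_moduleColon_bot :
    ∃ w : ℕ, Module.length R (moduleColon (⊥ : Submodule R M) (maximalIdeal R)) = (w : ℕ∞) := by
  obtain ⟨w, hw⟩ := ENat.ne_top_iff_exists.1 (length_ne_top_of_maximalIdeal_smul_eq_zero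
    (moduleColon (⊥ : Submodule R M) (maximalIdeal R)) fun r hr x => Subtype.ext (x.2 r hr))
  exact ⟨w, hw.symm⟩

/-- For large `n`, the length of `(𝔪 ^ (n + 1) M :_M 𝔪) / 𝔪 ^ (n + 1) M` is the sum of the
difference of the Hilbert–Samuel function and the length of the socle of `M`. -/
lemma eventually_length_moduleColon_quotient {w : ℕ}
    (hw : Module.length R (moduleColon (⊥ : Submodule R M) (maximalIdeal R)) = (w : ℕ∞)) :
    ∀ᶠ n in atTop, ∃ k : ℕ,
      Module.length R
        (moduleColon (maximalIdeal R ^ (n + 1) • (⊤ : Submodule R M)) (maximalIdeal R) ⧸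
          (maximalIdeal R ^ (n + 1) • (⊤ : Submodule R M)).submoduleOf
            (moduleColon (maximalIdeal R ^ (n + 1) • (⊤ : Submodule R M)) (maximalIdeal R)))
        = (k : ℕ∞) ∧
      (k : ℤ) = (bdiff (hilbertSamuel R M) + fun _ => (w : ℤ) : ℕ → ℤ) n := by
  filter_upwards [eventually_moduleColon_pow_eq (M := M) (maximalIdeal R),
    eventually_pow_inf_moduleColon_bot_eq_bot (M := M) (maximalIdeal R),
    eventually_ge_atTop 1] with n h1 h2 hn
  have h3 := length_sup_quotient_of_inf_eq_bot h2
  rw [hw] at h3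
  obtain ⟨l, hl, hl'⟩ := length_subquotient_eq
    (le_sup_left : maximalIdeal R ^ n • (⊤ : Submodule R M) ≤ maximalIdeal R ^ n • ⊤ ⊔
      moduleColon (⊥ : Submodule R M) (maximalIdeal R))
    (length_quotient_maximalIdeal_pow_ne_top n)
  rw [h3] at hl
  norm_cast at hl
  subst hl
  rw [← h1] at hl'
  obtain ⟨k, hk, hk'⟩ := length_subquotient_eq
    (P := moduleColon (maximalIdeal R ^ (n + 1) • (⊤ : Submodule R M)) (maximalIdeal R))
    (le_moduleColon_iff.2 ((smul_pow_smul_top (M := M) (maximalIdeal R) (n + 1)).le.trans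
      (pow_smul_top_antitone _ (n + 1).le_succ)))
    (length_quotient_maximalIdeal_pow_ne_top (n + 1))
  refine ⟨k, hk, ?_⟩
  -- The colon has colength χ(n) - k, and also χ(n-1) - w by the direct sum; equating them gives k.
  simp only [Pi.add_apply, bdiff_apply, hilbertSamuel, Nat.sub_add_cancel hn]
  omega

lemma hasHilbertCoeffs_iff {t : ℕ} {e : Fin (t + 1) → ℤ} :
    HasHilbertCoeffs M (maximalIdeal R) t e ↔
      hilbertSamuel R M =ᶠ[atTop] binomialSum t e := by
  refine eventually_congr (Eventually.of_forall fun n => ?_)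
  have h := length_eq_colength (length_quotient_maximalIdeal_pow_ne_top (R := R) (M := M) (n + 1))
  rw [h]
  constructor
  · rintro ⟨k, hk, hk'⟩
    norm_cast at hk
    rw [hilbertSamuel, hk]
    exact hk'
  · exact fun H => ⟨_, rfl, H⟩

lemma hasIrreducibilityCoeffs_iff {w : ℕ}
    (hw : Module.length R (moduleColon (⊥ : Submodule R M) (maximalIdeal R)) = (w : ℕ∞))
    {d : ℕ} {f : Fin (d + 1) → ℤ} :
    HasIrreducibilityCoeffs M (maximalIdeal R) (d + 1) f ↔
      (bdiff (hilbertSamuel R M) + fun _ => (w : ℤ) : ℕ → ℤ) =ᶠ[atTop] binomialSum d f := by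
  refine eventually_congr ?_
  filter_upwards [eventually_length_moduleColon_quotient hw] with n hn
  obtain ⟨k, hk, hk'⟩ := hn
  rw [hk, ← hk']
  constructor
  · rintro ⟨l, hl, hl'⟩
    norm_cast at hl
    rw [hl]
    exact hl'
  · exact fun H => ⟨k, rfl, H⟩

end

end IrrMult

/-! ### Existence, uniqueness and comparison of the multiplicities -/

theorem mainTheorem2 {R : Type*} [CommRing R] [IsLocalRing R] [IsNoetherianRing R]
    (M : Type*) [AddCommGroup M] [Module R M] [Module.Finite R M]
    (t : ℕ) (ht : 1 ≤ t) (hdim : Module.supportDim R M = (t : WithBot ℕ∞)) :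
    (∃! e : ℤ, IrrMult.IsHilbertMultiplicity M (IsLocalRing.maximalIdeal R) e) ∧
    (∃! f : ℤ, IrrMult.IsIrreducibleMultiplicity M (IsLocalRing.maximalIdeal R) f) ∧
    ∀ e f : ℤ, IrrMult.IsHilbertMultiplicity M (IsLocalRing.maximalIdeal R) e →
      IrrMult.IsIrreducibleMultiplicity M (IsLocalRing.maximalIdeal R) f →
      (t ≠ 1 → f = e) ∧
      (t = 1 → ∃ s : ℕ,
        Module.length R (IrrMult.moduleColon (⊥ : Submodule R M) (IsLocalRing.maximalIdeal R))
          = (s : ℕ∞) ∧ f = e + (s : ℤ)) := by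
  open IrrMult Filter in
  obtain ⟨d, rfl⟩ := Nat.exists_eq_add_of_le' ht
  obtain ⟨w, hw⟩ := exists_length_moduleColon_bot R M
  have hχ := bdiff_pow_hilbertSamuel hdim
  have hφ : (bdiff ^ (d + 1)) (bdiff (hilbertSamuel R M) + fun _ => (w : ℤ) : ℕ → ℤ) =ᶠ[atTop] 0 := by
    rw [map_add, bdiff_pow_const _ d.succ_ne_zero, add_zero, ← Module.End.mul_apply, ← pow_succ]
    exact hχ
  obtain ⟨e, he⟩ := exists_eventuallyEq_binomialSum _ hχ
  obtain ⟨f, hf⟩ := exists_eventuallyEq_binomialSum _ hφ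
  have he' : IsHilbertMultiplicity M (IsLocalRing.maximalIdeal R) (e 0) :=
    ⟨_, hdim, e, hasHilbertCoeffs_iff.2 he, rfl⟩
  have hf' : IsIrreducibleMultiplicity M (IsLocalRing.maximalIdeal R) (f 0) :=
    ⟨_, d.succ_pos, hdim, f, (hasIrreducibilityCoeffs_iff hw).2 hf, rfl⟩
  have hE : ∀ a, IsHilbertMultiplicity M (IsLocalRing.maximalIdeal R) a →
      (bdiff ^ (d + 1)) (hilbertSamuel R M) =ᶠ[atTop] fun _ => a := by
    rintro a ⟨t, h, e, he, rfl⟩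
    obtain rfl : t = d + 1 := by rw [hdim] at h; exact_mod_cast h.symm
    exact binomialSum_leading_unique (hasHilbertCoeffs_iff.1 he)
  have hF : ∀ a, IsIrreducibleMultiplicity M (IsLocalRing.maximalIdeal R) a →
      (bdiff ^ d) (bdiff (hilbertSamuel R M) + fun _ => (w : ℤ) : ℕ → ℤ) =ᶠ[atTop] fun _ => a := by
    rintro a ⟨t, _, h, f, hf, rfl⟩
    obtain rfl : t = d + 1 := by rw [hdim] at h; exact_mod_cast h.symm
    exact binomialSum_leading_unique ((hasIrreducibilityCoeffs_iff hw).1 hf)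
  refine ⟨⟨e 0, he', fun a ha => ?_⟩, ⟨f 0, hf', fun a ha => ?_⟩, fun a b ha hb => ?_⟩
  · exact ((hE a ha).symm.trans (hE _ he')).exists.choose_spec
  · exact ((hF a ha).symm.trans (hF _ hf')).exists.choose_spec
  · have h1 := hE a ha
    have h2 := hF b hb
    -- With t = d + 1, this reads b = a + Δ^d w: the d-th difference of the constant w is 0 for d >
    -- 0 and w for d = 0.
    rw [map_add, ← Module.End.mul_apply, ← pow_succ] at h2
    obtain ⟨n, h1, h2⟩ := (h1.and h2).exists
    rw [Pi.add_apply, h1] at h2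
    constructor
    · intro hd
      rw [bdiff_pow_const _ (by omega)] at h2
      simpa using h2.symm
    · intro hd
      obtain rfl : d = 0 := by omega
      exact ⟨w, hw, by simpa using h2.symm⟩
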